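/- Let $2\le k\le n$ be integers, and let $X_1,\dots,X_n,Y$ be Banach spaces over $\mathbb K=\mathbb R$ or $\mathbb C$. A Banach space $X$ has cotype $s$ (with $2\le s<\infty$) if there is a constant $C$ such that $$\Big(\sum_{i=1}^m\|x_i\|^s\Big)^{1/s}\le C\Big(2^{-m}\sum_{\varepsilon\in\{-1,1\}^m}\Big\|\sum_{i=1}^m\varepsilon_i x_i\Big\|^2\Big)^{1/2}$$ for all $m$ and all $x_1,\dots,x_m\in X$. For $1\le q<\infty$, a sequence $(x_j)_{j\ge1}$ in $X$ is weakly $q$-summable if $\sup_{\varphi\in X^*,\,\|\varphi\|\le1}\sum_j|\varphi(x_j)|^q<\infty$. For exponents $p,q_1,\dots,q_n\in[1,\infty)$ with $1/p\le 1/q_1+\cdots+1/q_n$, let $\Pi^n_{p;q_1,\dots,q_n}(X_1,\dots,X_n;Y)$ be the set of continuous $n$-linear operators $T:X_1\times\cdots\times X_n\to Y$ such that $\sum_j\|T(x^{(1)}_j,\dots,x^{(n)}_j)\|^p<\infty$ whenever $(x^{(i)}_j)_j$ is weakly $q_i$-summable in $X_i$ for every $i=1,\dots,n$; write $\Pi^n_{p;p}$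 when $q_1=\cdots=q_n=p$. Suppose that $X_j$ has finite cotype $s_j\ge2$ for $j=1,\dots,k$, and that $1\le 1/s_1+\cdots+1/s_k$. Let $s_j^*=s_j/(s_j-1)$, and let $p,r$ be real numbers such that $$1\le r<p<\min_{1\le j\le k}s_j^*\quad\text{if } s_j\ne2\text{ for some } j\in\{1,\dots,k\},$$ $$1\le r<p\le2\quad\text{if } s_j=2\text{ for all } j\in\{1,\dots,k\}.$$ Then, for every $q\in[1,\infty)$, $$\Pi^n_{p;p,\dots,p,q,\dots,q}(X_1,\dots,X_n;Y)\subseteq\Pi^n_{r;r,\dots,r,q,\dots,q}(X_1,\dots,X_n;Y),$$ where the exponents $p$ (respectively $r$) after the semicolon occupy the first $k$ places and $q$ the remaining $n-k$ places. In particular, $$\Pi^n_{p;p}(X_1,\dots,X_n;Y)\subseteq\Pi^n_{r;r}(X_1,\dots,X_n;Y).$$ -/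

import Mathlib

open scoped ENNReal

/-- The average of `‖ε₁ x₁ + ⋯ + εₘ xₘ‖ ^ 2` over all choices of signs `εᵢ = ±1`. It equals
`∫ ‖∑ rᵢ(t) xᵢ‖ ^ 2 dt` over `[0, 1]`, with `rᵢ` the Rademacher functions. -/
noncomputable def rademacherSqMean {X : Type*} [NormedAddCommGroup X] {m : ℕ}
    (x : Fin m → X) : ℝ :=
  (∑ ε : Fin m → ℤˣ, ‖∑ i, ((ε i : ℤˣ) : ℤ) • x i‖ ^ 2) / 2 ^ m

/-- `X` has (finite, Rademacher) cotype `s`: there is a constant `C` with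
`(∑ ‖xᵢ‖ ^ s) ^ (1 / s) ≤ C * (𝔼 ‖∑ εᵢ xᵢ‖ ^ 2) ^ (1 / 2)` for every finite family in `X`. -/
def HasCotype (X : Type*) [NormedAddCommGroup X] (s : ℝ) : Prop :=
  ∃ C : ℝ, ∀ (m : ℕ) (x : Fin m → X),
    (∑ i, ‖x i‖ ^ s) ^ (1 / s) ≤ C * (rademacherSqMean x) ^ (1 / 2 : ℝ)

/-- The set `ℓ_q^w(X)` of weakly `q`-summable sequences: the supremum over the closed unit ball
of the dual space of `∑ |φ(x_j)| ^ q` is finite. -/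
def WeaklySummable (𝕜 : Type*) [RCLike 𝕜] {X : Type*} [NormedAddCommGroup X] [NormedSpace 𝕜 X]
    (q : ℝ) (x : ℕ → X) : Prop :=
  (⨆ φ : StrongDual 𝕜 X, ⨆ _ : ‖φ‖ ≤ 1, ∑' j, ‖φ (x j)‖ₑ ^ q) < ∞

/-- The class `Π^n_{p; q₁, …, qₙ}(X₁, …, Xₙ; Y)` of absolutely `(p; q₁, …, qₙ)`-summing
continuous `n`-linear operators, meant for `0 < p, q₁, …, qₙ < ∞` and
`1 / p ≤ 1 / q₁ + ⋯ + 1 / qₙ`. -/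
def absSumming (𝕜 : Type*) [RCLike 𝕜] {n : ℕ} (X : Fin n → Type*)
    [∀ i, NormedAddCommGroup (X i)] [∀ i, NormedSpace 𝕜 (X i)]
    (Y : Type*) [NormedAddCommGroup Y] [NormedSpace 𝕜 Y]
    (p : ℝ) (q : Fin n → ℝ) : Set (ContinuousMultilinearMap 𝕜 X Y) :=
  {T | ∀ x : ∀ i, ℕ → X i, (∀ i, WeaklySummable 𝕜 (q i) (x i)) →
    Memℓp (fun j => T fun i => x i j) (ENNReal.ofReal p)}

/-- The tuple of exponents `(a, …, a, b, …, b)` of length `n` whose first `k` entries are `a`. -/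
def splitExponents (n k : ℕ) (a b : ℝ) : Fin n → ℝ :=
  fun i => if (i : ℕ) < k then a else b

/-! ### Weakly summable sequences -/

section WeaklySummable

variable {𝕜 : Type*} [RCLike 𝕜] {X : Type*} [NormedAddCommGroup X] [NormedSpace 𝕜 X]

/-! Multiplying by `β` in `ℓ_{r'}` makes a weakly `r`-summable sequence weakly `1`-summable. If the
space has cotype `s` and `P < s*`, then `β x = α y` with `α` in `ℓ_{P'}` and `y` weakly `P`-summable
(`HasCotype.exists_smul_eq`). Doing this in two coordinates gives `β² ‖T x‖ = α₀ α₁ ‖T y‖`, which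
lies in `ℓ_ρ` with `1/ρ = 2/P' + 1/p`. Taking `2/P = 1/r + 1/p` makes `1/ρ = 1/r + 2/r'`, so a
converse of Hölder's inequality, proved by Abel–Dini, puts `T x` in `ℓ_r`. A single coordinate would
force `P = p < s*`; two allow `P < p`, hence also the endpoint `p = s*`.

The factorization rests on Pisier's domination `‖∑ h_j x_j‖ ^ s ≤ ∑ μ_j |h_j|` for `|h_j| ≤ 1`. It
makes `φ(x_j) / μ_j` bounded in weak `L^{s*}(μ)`, hence in `L^P(μ)`, uniformly over the unit ball of
the dual. -/

theorem WeaklySummable.exists_bound {q : ℝ} {x : ℕ → X} (hx : WeaklySummable 𝕜 q x) :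
    ∃ K : ℝ≥0∞, K < ∞ ∧ ∀ φ : StrongDual 𝕜 X, ‖φ‖ ≤ 1 → ∑' j, ‖φ (x j)‖ₑ ^ q ≤ K :=
  ⟨_, hx, fun φ hφ => le_iSup₂_of_le φ hφ le_rfl⟩

theorem weaklySummable_of_bound {q : ℝ} {x : ℕ → X} {K : ℝ≥0∞} (hK : K < ∞)
    (h : ∀ φ : StrongDual 𝕜 X, ‖φ‖ ≤ 1 → ∑' j, ‖φ (x j)‖ₑ ^ q ≤ K) :
    WeaklySummable 𝕜 q x :=
  (iSup₂_le h).trans_lt hK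

theorem WeaklySummable.mono {p r : ℝ} (hr : 0 < r) (hrp : r ≤ p) {x : ℕ → X}
    (hx : WeaklySummable 𝕜 r x) : WeaklySummable 𝕜 p x := by
  obtain ⟨K, hK, h⟩ := hx.exists_bound
  refine weaklySummable_of_bound (K := K ^ ((p - r) / r) * K)
    (ENNReal.mul_lt_top (ENNReal.rpow_lt_top_of_nonneg (div_nonneg (by linarith) hr.le) hK.ne) hK) fun φ hφ => ?_
  calc ∑' j, ‖φ (x j)‖ₑ ^ p ≤ ∑' j, K ^ ((p - r) / r) * ‖φ (x j)‖ₑ ^ r := by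
        refine ENNReal.tsum_le_tsum fun j => ?_
        have hj : ‖φ (x j)‖ₑ ^ r ≤ K := (ENNReal.le_tsum j).trans (h φ hφ)
        have : ‖φ (x j)‖ₑ ^ p = (‖φ (x j)‖ₑ ^ r) ^ ((p - r) / r) * ‖φ (x j)‖ₑ ^ r := by
          rw [← ENNReal.rpow_mul, mul_div_cancel₀ _ hr.ne',
            ← ENNReal.rpow_add_of_nonneg _ _ (by linarith) hr.le]
          congr 1; ring
        rw [this]
        gcongr
    _ = K ^ ((p - r) / r) * ∑' j, ‖φ (x j)‖ₑ ^ r := ENNReal.tsum_mul_left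
    _ ≤ _ := by gcongr; exact h φ hφ

/-- Hölder's inequality `ℓ_{r'} · ℓ_r^w ⊆ ℓ_1^w`. -/
theorem WeaklySummable.smul {r r' : ℝ} (hr : r.HolderConjugate r') {x : ℕ → X}
    (hx : WeaklySummable 𝕜 r x) {β : ℕ → ℝ} (hβ0 : ∀ j, 0 ≤ β j)
    (hβ : Summable fun j => β j ^ r') :
    WeaklySummable 𝕜 1 (fun j => (β j : 𝕜) • x j) := by
  obtain ⟨K, hK, h⟩ := hx.exists_bound
  have hB : ∑' j, ENNReal.ofReal (β j) ^ r' < ∞ := by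
    have := hβ.tsum_ofReal_lt_top
    simpa only [ENNReal.ofReal_rpow_of_nonneg (hβ0 _) hr.symm.nonneg] using this
  refine weaklySummable_of_bound (K := K + ∑' j, ENNReal.ofReal (β j) ^ r')
    (ENNReal.add_lt_top.2 ⟨hK, hB⟩) fun φ hφ => ?_
  calc ∑' j, ‖φ ((β j : 𝕜) • x j)‖ₑ ^ (1 : ℝ)
      ≤ ∑' j, (‖φ (x j)‖ₑ ^ r + ENNReal.ofReal (β j) ^ r') := by
        refine ENNReal.tsum_le_tsum fun j => ?_
        have h1 : ‖φ ((β j : 𝕜) • x j)‖ₑ = ‖φ (x j)‖ₑ * ENNReal.ofReal (β j) := by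
          rw [map_smul, smul_eq_mul, enorm_mul, mul_comm]
          congr 1
          rw [← ofReal_norm, RCLike.norm_ofReal, abs_of_nonneg (hβ0 j)]
        rw [ENNReal.rpow_one, h1]
        refine (ENNReal.young_inequality _ _ hr).trans ?_
        gcongr
        · exact ENNReal.div_le_of_le_mul (le_mul_of_one_le_right' (by
            simpa using hr.lt.le))
        · exact ENNReal.div_le_of_le_mul (le_mul_of_one_le_right' (by
            simpa using hr.symm.lt.le))
    _ = ∑' j, ‖φ (x j)‖ₑ ^ r + ∑' j, ENNReal.ofReal (β j) ^ r' := ENNReal.tsum_add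
    _ ≤ _ := by gcongr; exact h φ hφ

theorem WeaklySummable.exists_norm_sum_smul_le {x : ℕ → X} (hx : WeaklySummable 𝕜 1 x) :
    ∃ K : ℝ, 0 ≤ K ∧ ∀ (F : Finset ℕ) (g : ℕ → 𝕜), (∀ j, ‖g j‖ ≤ 1) →
      ‖∑ j ∈ F, g j • x j‖ ≤ K := by
  obtain ⟨K, hK, h⟩ := hx.exists_bound
  refine ⟨K.toReal, ENNReal.toReal_nonneg, fun F g hg => ?_⟩
  obtain ⟨φ, hφ, hφx⟩ := exists_dual_vector'' 𝕜 (∑ j ∈ F, g j • x j)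
  have h1 : ∑ j ∈ F, ‖φ (x j)‖ ≤ K.toReal := by
    rw [← ENNReal.ofReal_le_iff_le_toReal hK.ne,
      ENNReal.ofReal_sum_of_nonneg fun _ _ => norm_nonneg _]
    refine le_trans ?_ (h φ hφ)
    simpa using ENNReal.sum_le_tsum (f := fun j => ‖φ (x j)‖ₑ) F
  calc ‖∑ j ∈ F, g j • x j‖ = ‖φ (∑ j ∈ F, g j • x j)‖ := by rw [hφx]; simp
    _ ≤ ∑ j ∈ F, ‖φ (x j)‖ := by
      rw [map_sum]
      refine norm_sum_le_of_le _ fun j _ => ?_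
      rw [map_smul, norm_smul]
      exact mul_le_of_le_one_left (norm_nonneg _) (hg j)
    _ ≤ _ := h1

end WeaklySummable

/-! ### Cotype and weakly `1`-summable sequences -/

section Cotype

variable {𝕜 : Type*} [RCLike 𝕜] {X : Type*} [NormedAddCommGroup X]

theorem norm_units_int_zsmul {E : Type*} [SeminormedAddCommGroup E] (ε : ℤˣ) (z : E) :
    ‖(ε : ℤ) • z‖ = ‖z‖ := by
  rcases Int.units_eq_one_or ε with rfl | rfl <;> simp

theorem rademacherSqMean_nonneg {m : ℕ} (x : Fin m → X) : 0 ≤ rademacherSqMean x := by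
  unfold rademacherSqMean; positivity

theorem rademacherSqMean_le {m : ℕ} {x : Fin m → X} {K : ℝ}
    (h : ∀ ε : Fin m → ℤˣ, ‖∑ i, ((ε i : ℤˣ) : ℤ) • x i‖ ≤ K) :
    rademacherSqMean x ≤ K ^ 2 := by
  unfold rademacherSqMean
  rw [div_le_iff₀ (by positivity)]
  calc _ ≤ ∑ _ε : Fin m → ℤˣ, K ^ 2 := Finset.sum_le_sum fun ε _ => by gcongr; exact h ε
    _ = K ^ 2 * 2 ^ m := by simp [mul_comm]

/-- In a space of cotype `s` the map `f ↦ ∑ f j • x j` is `(s, 1)`-summing on bounded scalar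
sequences, for every weakly `1`-summable sequence `x`. -/
theorem HasCotype.exists_sum_rpow_le [NormedSpace 𝕜 X] {s : ℝ} (hs : 0 < s)
    (hX : HasCotype X s) {x : ℕ → X} (hx : WeaklySummable 𝕜 1 x) :
    ∃ M : ℝ, ∀ (F : Finset ℕ) (N : ℕ) (f : Fin N → ℕ → 𝕜), (∀ j, ∑ i, ‖f i j‖ ≤ 1) →
      ∑ i, ‖∑ j ∈ F, f i j • x j‖ ^ s ≤ M := by
  obtain ⟨K, hK0, hK⟩ := hx.exists_norm_sum_smul_le
  obtain ⟨C, hC⟩ := hX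
  refine ⟨(|C| * K) ^ s, fun F N f hf => ?_⟩
  have h1 : rademacherSqMean (fun i => ∑ j ∈ F, f i j • x j) ≤ K ^ 2 := by
    refine rademacherSqMean_le fun ε => ?_
    -- Each signed sum has coefficients `∑ i, ε i • f i j` of modulus at most `1`, so it obeys the
    -- bound `K`; no averaging over signs is needed.
    have : ∑ i, ((ε i : ℤˣ) : ℤ) • ∑ j ∈ F, f i j • x j =
        ∑ j ∈ F, (∑ i, ((ε i : ℤˣ) : ℤ) • f i j) • x j := by
      simp_rw [Finset.smul_sum, Finset.sum_smul, smul_assoc]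
      exact Finset.sum_comm
    rw [this]
    refine hK F _ fun j => (norm_sum_le_of_le _ fun i _ => ?_).trans (hf j)
    exact (norm_units_int_zsmul _ _).le
  have h2 := hC N (fun i => ∑ j ∈ F, f i j • x j)
  have h0 : 0 ≤ ∑ i, ‖∑ j ∈ F, f i j • x j‖ ^ s :=
    Finset.sum_nonneg fun i _ => by positivity
  have h3 : (rademacherSqMean (fun i => ∑ j ∈ F, f i j • x j)) ^ (1 / 2 : ℝ) ≤ K := by
    rw [← Real.sqrt_eq_rpow]
    exact Real.sqrt_le_iff.2 ⟨hK0, h1⟩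
  have h4 : (∑ i, ‖∑ j ∈ F, f i j • x j‖ ^ s) ^ (1 / s) ≤ |C| * K := by
    refine h2.trans ?_
    gcongr
    · exact Real.rpow_nonneg (rademacherSqMean_nonneg _) _
    · exact le_abs_self C
  calc _ = ((∑ i, ‖∑ j ∈ F, f i j • x j‖ ^ s) ^ (1 / s)) ^ s := by
        rw [← Real.rpow_mul h0, one_div_mul_cancel hs.ne', Real.rpow_one]
    _ ≤ _ := by gcongr

end Cotype

/-! ### Pisier's domination theorem -/

section Domination

/-- Convexity: `u ^ s` lies above its tangent at `a`, which is Bernoulli's inequality at `b / a`. -/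
theorem rpow_tangent_le {s a b c : ℝ} (hs : 1 ≤ s) (ha : 0 ≤ a) (hb : 0 ≤ b) (h : a - c ≤ b) :
    a ^ s - s * (a ^ (s - 1) * c) ≤ b ^ s := by
  rcases ha.eq_or_lt with rfl | ha
  -- For `s = 1` the factor `0 ^ (s - 1)` is `1`, so this case needs `h`.
  · rcases hs.eq_or_lt with rfl | hs'
    · simpa using h
    · rw [Real.zero_rpow (by linarith), Real.zero_rpow (by linarith)]
      simpa using Real.rpow_nonneg hb s
  have h1 : 1 + s * (b / a - 1) ≤ (b / a) ^ s := by
    have := one_add_mul_self_le_rpow_one_add (s := b / a - 1)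
      (by have : 0 ≤ b / a := by positivity
          linarith) hs
    simpa using this
  rw [Real.div_rpow hb ha.le, le_div_iff₀ (by positivity)] at h1
  have h2 : a ^ s = a ^ (s - 1) * a := by
    rw [← Real.rpow_add_one ha.ne']; congr 1; ring
  have h3 : (1 + s * (b / a - 1)) * a ^ s = a ^ s + s * (a ^ (s - 1) * (b - a)) := by
    rw [h2]; field_simp
  have h4 : s * (a ^ (s - 1) * (a - b)) ≤ s * (a ^ (s - 1) * c) := by
    have : 0 ≤ a ^ (s - 1) := by positivity
    gcongr
    linarith
  have h5 : s * (a ^ (s - 1) * (a - b)) = - (s * (a ^ (s - 1) * (b - a))) := by ring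
  linarith

/-- Young's inequality with crude constants: replace the smaller of `a`, `b` by the larger. -/
theorem rpow_sub_one_mul_le {s a b : ℝ} (hs : 1 ≤ s) (ha : 0 ≤ a) (hb : 0 ≤ b) :
    a ^ (s - 1) * b ≤ a ^ s + b ^ s := by
  have key : ∀ c : ℝ, 0 ≤ c → c ^ (s - 1) * c = c ^ s := fun c hc => by
    rw [← Real.rpow_add_one' hc (by linarith)]; congr 1; ring
  rcases le_total a b with h | h
  · calc a ^ (s - 1) * b ≤ b ^ (s - 1) * b := by
          gcongr
      _ = b ^ s := key b hb
      _ ≤ _ := by have := Real.rpow_nonneg ha s; linarith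
  · calc a ^ (s - 1) * b ≤ a ^ (s - 1) * a := by gcongr
      _ = a ^ s := key a ha
      _ ≤ _ := by have := Real.rpow_nonneg hb s; linarith

variable {𝕜 : Type*} [RCLike 𝕜] {X : Type*} [NormedAddCommGroup X] [NormedSpace 𝕜 X]

/-- One step of Pisier's argument: dual functionals of a nearly extremal family give a weight that
dominates the map `f ↦ ∑ f j • x j` up to an arbitrarily small error. -/
theorem exists_weight_add_error {s M : ℝ} (hs : 1 ≤ s) (x : ℕ → X) (F : Finset ℕ)
    (hM : ∀ (N : ℕ) (f : Fin N → ℕ → 𝕜), (∀ j, ∑ i, ‖f i j‖ ≤ 1) →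
      ∑ i, ‖∑ j ∈ F, f i j • x j‖ ^ s ≤ M) {η : ℝ} (hη : 0 < η) :
    ∃ μ : ℕ → ℝ, (∀ j, 0 ≤ μ j) ∧ (∀ j, j ∉ F → μ j = 0) ∧ ∑ j ∈ F, μ j ≤ s * (2 * M) ∧
      ∀ h : ℕ → 𝕜, (∀ j, ‖h j‖ ≤ 1) →
        ‖∑ j ∈ F, h j • x j‖ ^ s ≤ η + ∑ j ∈ F, μ j * ‖h j‖ := by
  set U : (ℕ → 𝕜) → X := fun f => ∑ j ∈ F, f j • x j with hU
  set S : Set ℝ := {v | ∃ (N : ℕ) (f : Fin N → ℕ → 𝕜), (∀ j, ∑ i, ‖f i j‖ ≤ 1) ∧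
    ∑ i, ‖U (f i)‖ ^ s = v} with hS
  have hSne : S.Nonempty := ⟨_, 0, fun i => i.elim0, by simp, rfl⟩
  have hSb : BddAbove S := ⟨M, by rintro _ ⟨N, f, hf, rfl⟩; exact hM N f hf⟩
  obtain ⟨_, ⟨N, f, hf, rfl⟩, hlt⟩ := exists_lt_of_lt_csSup hSne (sub_lt_self (sSup S) hη)
  choose φ hφ hφU using fun i => exists_dual_vector'' 𝕜 (U (f i))
  -- The derivative of `∑ ‖U (f i)‖ ^ s` under multiplication of all `f i` by a common sequence, up
  -- to the factor `s`.
  set lam : ℕ → 𝕜 := fun j =>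
    ∑ i, ((‖U (f i)‖ ^ (s - 1) : ℝ) : 𝕜) * (f i j * φ i (x j)) with hlam
  have hpair : ∀ g : ℕ → 𝕜, ∑ j ∈ F, g j * lam j =
      ∑ i, ((‖U (f i)‖ ^ (s - 1) : ℝ) : 𝕜) * φ i (U fun j => g j * f i j) := by
    intro g
    simp only [hlam, hU, map_sum, map_smul, smul_eq_mul, Finset.mul_sum]
    rw [Finset.sum_comm]
    refine Finset.sum_congr rfl fun i _ => Finset.sum_congr rfl fun j _ => by ring
  have hφle : ∀ i z, ‖φ i z‖ ≤ ‖z‖ := fun i z =>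
    ((φ i).le_of_opNorm_le (hφ i) z).trans (one_mul _).le
  have hs0 : 0 ≤ s := by linarith
  refine ⟨fun j => if j ∈ F then s * ‖lam j‖ else 0, fun j => by dsimp only; split_ifs <;> positivity,
    fun j hj => if_neg hj, ?_, fun h hh => ?_⟩
  · have hg : ∀ j, ∃ g : 𝕜, ‖g‖ ≤ 1 ∧ g * lam j = ‖lam j‖ := by
      intro j
      refine ⟨(starRingEnd 𝕜) (lam j) / ‖lam j‖, ?_, ?_⟩
      · rw [norm_div, RCLike.norm_conj, RCLike.norm_ofReal, abs_norm]
        exact div_self_le_one _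
      · rcases eq_or_ne (lam j) 0 with h0 | h0
        · simp [h0]
        · have : ((‖lam j‖ : ℝ) : 𝕜) ≠ 0 := by simpa using h0
          rw [div_mul_eq_mul_div, RCLike.conj_mul, sq, mul_div_assoc, div_self this, mul_one]
    choose g hg1 hg2 using hg
    have hgf : ∀ j, ∑ i, ‖g j * f i j‖ ≤ 1 := fun j => by
      simp_rw [norm_mul, ← Finset.mul_sum]
      exact mul_le_one₀ (hg1 j) (Finset.sum_nonneg fun _ _ => norm_nonneg _) (hf j)
    have h1 : ∑ j ∈ F, ‖lam j‖ ≤ 2 * M := by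
      have e : ((∑ j ∈ F, ‖lam j‖ : ℝ) : 𝕜) = ∑ j ∈ F, g j * lam j := by
        rw [RCLike.ofReal_sum]
        exact Finset.sum_congr rfl fun j _ => (hg2 j).symm
      have e2 : ∑ j ∈ F, ‖lam j‖ = ‖((∑ j ∈ F, ‖lam j‖ : ℝ) : 𝕜)‖ := by
        rw [RCLike.norm_ofReal, abs_of_nonneg (Finset.sum_nonneg fun _ _ => norm_nonneg _)]
      rw [e2, e, hpair]
      calc _ ≤ ∑ i, (‖U (f i)‖ ^ s + ‖U fun j => g j * f i j‖ ^ s) := by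
            refine norm_sum_le_of_le _ fun i _ => ?_
            rw [norm_mul, RCLike.norm_ofReal, abs_of_nonneg (by positivity)]
            refine le_trans ?_ (rpow_sub_one_mul_le hs (norm_nonneg _) (norm_nonneg _))
            gcongr
            exact hφle _ _
        _ ≤ M + M := by
            rw [Finset.sum_add_distrib]
            exact add_le_add (hM N f hf) (hM N (fun i j => g j * f i j) hgf)
        _ = 2 * M := by ring
    calc _ = s * ∑ j ∈ F, ‖lam j‖ := by
          rw [Finset.mul_sum]
          exact Finset.sum_congr rfl fun j hj => if_pos hj
      _ ≤ _ := by gcongr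
  -- Adjoining `h` and shrinking each `f i` by `1 - |h|` keeps the family admissible, so
  -- near-extremality of `f` bounds `‖U h‖ ^ s` by `η` plus the loss from shrinking, which the
  -- tangent inequality controls.
  · have hnew := le_csSup hSb (show _ ∈ S from ⟨N + 1,
      Fin.cons h fun i j => ((1 - ‖h j‖ : ℝ) : 𝕜) * f i j, fun j => by
        rw [Fin.sum_univ_succ]
        simp only [Fin.cons_zero, Fin.cons_succ, norm_mul, RCLike.norm_ofReal]
        rw [← Finset.mul_sum, abs_of_nonneg (by linarith [hh j])]
        nlinarith [hf j, hh j, norm_nonneg (h j)], rfl⟩)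
    rw [Fin.sum_univ_succ] at hnew
    simp only [Fin.cons_zero, Fin.cons_succ] at hnew
    have hterm : ∀ i, ‖U (f i)‖ ^ s - s * (‖U (f i)‖ ^ (s - 1) *
        RCLike.re (φ i (U fun j => ((‖h j‖ : ℝ) : 𝕜) * f i j))) ≤
        ‖U fun j => ((1 - ‖h j‖ : ℝ) : 𝕜) * f i j‖ ^ s := by
      intro i
      refine rpow_tangent_le hs (norm_nonneg _) (norm_nonneg _) ?_
      have e : U (fun j => ((1 - ‖h j‖ : ℝ) : 𝕜) * f i j) =
          U (f i) - U (fun j => ((‖h j‖ : ℝ) : 𝕜) * f i j) := by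
        simp only [hU, ← Finset.sum_sub_distrib, ← sub_smul]
        refine Finset.sum_congr rfl fun j _ => ?_
        congr 1
        push_cast
        ring
      calc _ = RCLike.re (φ i (U (fun j => ((1 - ‖h j‖ : ℝ) : 𝕜) * f i j))) := by
            rw [e, map_sub, hφU, map_sub, RCLike.ofReal_re]
        _ ≤ _ := (RCLike.re_le_norm _).trans (hφle _ _)
    have hsum := Finset.sum_le_sum fun i (_ : i ∈ Finset.univ) => hterm i
    rw [Finset.sum_sub_distrib, ← Finset.mul_sum] at hsum
    have hre : ∑ i, ‖U (f i)‖ ^ (s - 1) *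
        RCLike.re (φ i (U fun j => ((‖h j‖ : ℝ) : 𝕜) * f i j)) ≤ ∑ j ∈ F, ‖h j‖ * ‖lam j‖ := by
      have e := congrArg RCLike.re (hpair fun j => ((‖h j‖ : ℝ) : 𝕜))
      simp only [map_sum, RCLike.re_ofReal_mul] at e
      rw [← e]
      refine Finset.sum_le_sum fun j _ => ?_
      gcongr
      exact RCLike.re_le_norm _
    have hfin : ∑ j ∈ F, (if j ∈ F then s * ‖lam j‖ else 0) * ‖h j‖ =
        s * ∑ j ∈ F, ‖h j‖ * ‖lam j‖ := by
      rw [Finset.mul_sum]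
      refine Finset.sum_congr rfl fun j hj => ?_
      rw [if_pos hj]; ring
    rw [hfin]
    have := mul_le_mul_of_nonneg_left hre hs0
    linarith

/-- Pisier's domination theorem, for the map `f ↦ ∑ f j • x j` on bounded scalar sequences. -/
theorem exists_weight {s M : ℝ} (hs : 1 ≤ s) (x : ℕ → X)
    (hM : ∀ (F : Finset ℕ) (N : ℕ) (f : Fin N → ℕ → 𝕜), (∀ j, ∑ i, ‖f i j‖ ≤ 1) →
      ∑ i, ‖∑ j ∈ F, f i j • x j‖ ^ s ≤ M) :
    ∃ μ : ℕ → ℝ, (∀ j, 0 ≤ μ j) ∧ Summable μ ∧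
      ∀ (F : Finset ℕ) (h : ℕ → 𝕜), (∀ j, ‖h j‖ ≤ 1) →
        ‖∑ j ∈ F, h j • x j‖ ^ s ≤ ∑ j ∈ F, μ j * ‖h j‖ := by
  choose m hm0 hmF hmsum hm using fun n : ℕ =>
    exists_weight_add_error hs x (Finset.range n) (hM (Finset.range n))
      (η := 1 / ((n : ℝ) + 1)) (by positivity)
  have hpart : ∀ n (F : Finset ℕ), ∑ j ∈ F, m n j ≤ s * (2 * M) := by
    intro n F
    refine le_trans ?_ (hmsum n)
    rw [← Finset.sum_filter_add_sum_filter_not F (· ∈ Finset.range n),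
      Finset.sum_eq_zero (s := F.filter (· ∉ Finset.range n))
        (fun j hj => hmF n j (Finset.mem_filter.1 hj).2), add_zero]
    exact Finset.sum_le_sum_of_subset_of_nonneg (fun j hj => (Finset.mem_filter.1 hj).2)
      fun j _ _ => hm0 n j
  have hbox : ∀ n, m n ∈ Set.univ.pi fun _ : ℕ => Set.Icc 0 (s * (2 * M)) := fun n j _ =>
    ⟨hm0 n j, by simpa using hpart n {j}⟩
  -- The weights on `range n` lie in a compact product of intervals; a pointwise limit keeps the
  -- mass bound, and the error `1 / (n + 1)` vanishes.
  obtain ⟨μ, -, ψ, hψ, hlim⟩ :=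
    (isCompact_univ_pi fun _ : ℕ => isCompact_Icc (a := (0 : ℝ)) (b := s * (2 * M))).tendsto_subseq
      hbox
  rw [tendsto_pi_nhds] at hlim
  have hμ0 : ∀ j, 0 ≤ μ j := fun j => ge_of_tendsto' (hlim j) fun n => hm0 _ j
  refine ⟨μ, hμ0, summable_of_sum_le hμ0 (c := s * (2 * M)) fun F => ?_, fun F h hh => ?_⟩
  · exact le_of_tendsto' (tendsto_finsetSum F fun j _ => hlim j) fun n => hpart _ F
  · have hη : Filter.Tendsto (fun n => 1 / ((ψ n : ℝ) + 1)) Filter.atTop (nhds 0) :=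
      tendsto_one_div_add_atTop_nhds_zero_nat.comp hψ.tendsto_atTop
    have hR := hη.add (tendsto_finsetSum F fun j _ => (hlim j).mul_const ‖h j‖)
    rw [zero_add] at hR
    refine ge_of_tendsto hR ?_
    obtain ⟨n₀, hn₀⟩ := F.exists_nat_subset_range
    filter_upwards [Filter.eventually_ge_atTop n₀] with n hn
    have hsub : F ⊆ Finset.range (ψ n) := hn₀.trans (Finset.range_mono (hn.trans (hψ.id_le n)))
    have := hm (ψ n) (fun j => if j ∈ F then h j else 0) fun j => by
      split_ifs
      · exact hh j
      · simp
    simpa [ite_smul, apply_ite norm, Finset.sum_ite_mem, Finset.inter_eq_right.2 hsub] using this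

end Domination

/-! ### Factoring weakly `1`-summable sequences -/

section Splitting

/-- A weak-type bound of exponent `σ` bounds all strong moments of exponent `P < σ`. -/
theorem sum_rpow_mul_le_of_weak_type {P σ : ℝ} (hP : 0 < P) (hPσ : P < σ) {F : Finset ℕ}
    {μ h : ℕ → ℝ} (hμ : ∀ j, 0 ≤ μ j) (hh : ∀ j, 0 ≤ h j)
    (hweak : ∀ c : ℝ, 1 ≤ c → ∑ j ∈ F with c ≤ h j, μ j ≤ c ^ (-σ)) :
    ∑ j ∈ F, h j ^ P * μ j ≤ ∑ j ∈ F, μ j + 2 ^ P * (1 - (2 : ℝ) ^ (P - σ))⁻¹ := by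
  -- Dyadic layers: `2 ^ k ≤ h j < 2 ^ (k + 1)` when `h j ≥ 1`; the summand `1` covers `h j < 1`.
  have hk : ∀ j, ∃ k : ℕ, h j ^ P ≤
      1 + if (2 : ℝ) ^ k ≤ h j then ((2 : ℝ) ^ (k + 1)) ^ P else 0 := by
    intro j
    rcases lt_or_ge (h j) 1 with h1 | h1
    · refine ⟨0, (Real.rpow_le_one (hh j) h1.le hP.le).trans ?_⟩
      have : (0 : ℝ) ≤ if (2 : ℝ) ^ 0 ≤ h j then ((2 : ℝ) ^ (0 + 1)) ^ P else 0 := by positivity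
      linarith
    · obtain ⟨k, hk1, hk2⟩ := exists_nat_pow_near h1 (one_lt_two (α := ℝ))
      refine ⟨k, ?_⟩
      rw [if_pos hk1]
      have : h j ^ P ≤ ((2 : ℝ) ^ (k + 1)) ^ P := Real.rpow_le_rpow (hh j) hk2.le hP.le
      linarith
  choose k hk using hk
  set N := F.sup k + 1
  have hρ0 : 0 ≤ (2 : ℝ) ^ (P - σ) := by positivity
  have hρ1 : (2 : ℝ) ^ (P - σ) < 1 := Real.rpow_lt_one_of_one_lt_of_neg one_lt_two (by linarith)
  have hpt : ∀ j ∈ F, h j ^ P * μ j ≤ μ j +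
      ∑ i ∈ Finset.range N, ((2 : ℝ) ^ (i + 1)) ^ P * if (2 : ℝ) ^ i ≤ h j then μ j else 0 := by
    intro j hj
    have h1 := mul_le_mul_of_nonneg_right (hk j) (hμ j)
    have h2 : ((2 : ℝ) ^ (k j + 1)) ^ P * (if (2 : ℝ) ^ k j ≤ h j then μ j else 0) ≤
        ∑ i ∈ Finset.range N, ((2 : ℝ) ^ (i + 1)) ^ P * if (2 : ℝ) ^ i ≤ h j then μ j else 0 := by
      refine Finset.single_le_sum (f := fun i : ℕ =>
        ((2 : ℝ) ^ (i + 1)) ^ P * if (2 : ℝ) ^ i ≤ h j then μ j else 0) (fun i _ => ?_) ?_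
      · have := hμ j
        positivity
      · exact Finset.mem_range.2 (Nat.lt_succ_of_le (Finset.le_sup hj))
    refine h1.trans (le_trans (le_of_eq ?_) (add_le_add le_rfl h2))
    split_ifs <;> ring
  refine (Finset.sum_le_sum hpt).trans ?_
  rw [Finset.sum_add_distrib, Finset.sum_comm]
  gcongr
  calc _ ≤ ∑ i ∈ Finset.range N, 2 ^ P * ((2 : ℝ) ^ (P - σ)) ^ i := by
        refine Finset.sum_le_sum fun i _ => ?_
        rw [← Finset.mul_sum, ← Finset.sum_filter]
        calc _ ≤ ((2 : ℝ) ^ (i + 1)) ^ P * ((2 : ℝ) ^ i) ^ (-σ) := by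
              gcongr
              exact hweak _ (one_le_pow₀ one_le_two)
          _ = _ := by
              rw [← Real.rpow_natCast_mul two_pos.le, ← Real.rpow_natCast_mul two_pos.le,
                ← Real.rpow_mul_natCast two_pos.le, ← Real.rpow_add two_pos,
                ← Real.rpow_add two_pos]
              congr 1
              push_cast
              ring
    _ = 2 ^ P * ∑ i ∈ Finset.range N, ((2 : ℝ) ^ (P - σ)) ^ i := (Finset.mul_sum _ _ _).symm
    _ ≤ _ := by
        gcongr
        rw [← tsum_geometric_of_lt_one hρ0 hρ1]
        exact (summable_geometric_of_lt_one hρ0 hρ1).sum_le_tsum _ fun i _ => by positivity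

variable {𝕜 : Type*} [RCLike 𝕜] {X : Type*} [NormedAddCommGroup X] [NormedSpace 𝕜 X]

/-- In a space of cotype `s` every weakly `1`-summable sequence factors as the product of a scalar
sequence in `ℓ_t` and a weakly `P`-summable sequence, whenever `P < s*` and `1 / P + 1 / t = 1`. -/
theorem HasCotype.exists_smul_eq {s P t : ℝ} (hs : 1 < s) (hP : P.HolderConjugate t)
    (hPs : P < Real.conjExponent s) (hX : HasCotype X s) {x : ℕ → X}
    (hx : WeaklySummable 𝕜 1 x) :
    ∃ (α : ℕ → ℝ) (y : ℕ → X), (∀ j, 0 ≤ α j) ∧ (Summable fun j => α j ^ t) ∧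
      WeaklySummable 𝕜 P y ∧ ∀ j, x j = (α j : 𝕜) • y j := by
  have hs0 : 0 < s := by linarith
  obtain ⟨M, hM⟩ := hX.exists_sum_rpow_le hs0 hx
  obtain ⟨μ, hμ0, hμs, hμ⟩ := exists_weight hs.le x hM
  have ht := hP.symm.pos
  have hα : ∀ j, (μ j ^ (1 / t)) ^ t = μ j := fun j => by
    rw [← Real.rpow_mul (hμ0 j), one_div_mul_cancel ht.ne', Real.rpow_one]
  -- Makes the convention `0⁻¹ = 0` harmless in `y j = μ j ^ (-1 / t) • x j`.
  have hx0 : ∀ j, μ j = 0 → x j = 0 := fun j hj => by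
    have := hμ {j} (fun _ => 1) (by simp)
    simp only [Finset.sum_singleton, one_smul, hj, zero_mul] at this
    have h0 : ‖x j‖ ^ s = 0 := le_antisymm this (by positivity)
    simpa using (Real.rpow_eq_zero (norm_nonneg _) hs0.ne').1 h0
  refine ⟨fun j => μ j ^ (1 / t), fun j => ((μ j ^ (1 / t) : ℝ) : 𝕜)⁻¹ • x j,
    fun j => Real.rpow_nonneg (hμ0 j) _, by simpa only [hα] using hμs, ?_, fun j => ?_⟩
  swap
  · rcases (hμ0 j).eq_or_lt with h | h
    · simp [hx0 j h.symm]
    · have : ((μ j ^ (1 / t) : ℝ) : 𝕜) ≠ 0 :=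
        RCLike.ofReal_ne_zero.2 (Real.rpow_pos_of_pos h _).ne'
      exact (smul_inv_smul₀ this _).symm
  set K : ℝ := ∑' j, μ j + 2 ^ P * (1 - (2 : ℝ) ^ (P - Real.conjExponent s))⁻¹ with hK
  refine weaklySummable_of_bound (K := ENNReal.ofReal K) ENNReal.ofReal_lt_top fun φ hφ => ?_
  have hb : ∀ F : Finset ℕ, (∑ j ∈ F, ‖φ (x j)‖) ^ s ≤ ∑ j ∈ F, μ j := by
    intro F
    have hg : ∀ j, ∃ g : 𝕜, ‖g‖ ≤ 1 ∧ g * φ (x j) = ‖φ (x j)‖ := by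
      intro j
      refine ⟨(starRingEnd 𝕜) (φ (x j)) / ‖φ (x j)‖, ?_, ?_⟩
      · rw [norm_div, RCLike.norm_conj, RCLike.norm_ofReal, abs_norm]
        exact div_self_le_one _
      · rcases eq_or_ne (φ (x j)) 0 with h0 | h0
        · simp [h0]
        · have : ((‖φ (x j)‖ : ℝ) : 𝕜) ≠ 0 := by simpa using h0
          rw [div_mul_eq_mul_div, RCLike.conj_mul, sq, mul_div_assoc, div_self this, mul_one]
    choose g hg1 hg2 using hg
    have e : φ (∑ j ∈ F, g j • x j) = ((∑ j ∈ F, ‖φ (x j)‖ : ℝ) : 𝕜) := by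
      rw [map_sum, RCLike.ofReal_sum]
      exact Finset.sum_congr rfl fun j _ => by rw [map_smul, smul_eq_mul, hg2]
    have h1 : ∑ j ∈ F, ‖φ (x j)‖ ≤ ‖∑ j ∈ F, g j • x j‖ := by
      have := (φ.le_of_opNorm_le hφ (∑ j ∈ F, g j • x j))
      rwa [e, RCLike.norm_ofReal, abs_of_nonneg (Finset.sum_nonneg fun _ _ => norm_nonneg _),
        one_mul] at this
    calc _ ≤ ‖∑ j ∈ F, g j • x j‖ ^ s := by gcongr
      _ ≤ ∑ j ∈ F, μ j * ‖g j‖ := hμ F g hg1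
      _ ≤ _ := Finset.sum_le_sum fun j _ => mul_le_of_le_one_right (hμ0 j) (hg1 j)
  -- If `m` is the mass of the level set, then `c m ≤ ∑ |φ(x_j)| ≤ m ^ (1 / s)`; solve for `m`.
  have hweak : ∀ (F : Finset ℕ) (c : ℝ), 1 ≤ c →
      ∑ j ∈ F with c ≤ ‖φ (x j)‖ / μ j, μ j ≤ c ^ (-Real.conjExponent s) := by
    intro F c hc
    have hc0 : 0 < c := by linarith
    set G := {j ∈ F | c ≤ ‖φ (x j)‖ / μ j} with hG
    rcases (Finset.sum_nonneg fun j (_ : j ∈ G) => hμ0 j).eq_or_lt with h0 | h0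
    · rw [← h0]; positivity
    set m := ∑ j ∈ G, μ j with hm
    have h1 : c * m ≤ ∑ j ∈ G, ‖φ (x j)‖ := by
      rw [hm, Finset.mul_sum]
      refine Finset.sum_le_sum fun j hj => ?_
      have hcj := (Finset.mem_filter.1 hj).2
      rcases (hμ0 j).eq_or_lt with h | h
      · rw [← h]; simp
      · exact (le_div_iff₀ h).1 hcj
    have h2 : (c * m) ^ s ≤ m := (by gcongr : (c * m) ^ s ≤ _).trans (hb G)
    rw [Real.mul_rpow hc0.le h0.le] at h2
    have h3 : c ^ s * m ^ (s - 1) ≤ 1 := by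
      rw [Real.rpow_sub_one h0.ne', ← mul_div_assoc, div_le_one h0]
      exact h2
    have h4 : m ^ (s - 1) ≤ c ^ (-s) := by
      rw [Real.rpow_neg hc0.le, ← one_div, le_div_iff₀ (by positivity)]
      linarith
    have hs1 : s - 1 ≠ 0 := by linarith
    calc m = (m ^ (s - 1)) ^ (1 / (s - 1)) := by
          rw [← Real.rpow_mul h0.le, mul_one_div_cancel hs1, Real.rpow_one]
      _ ≤ (c ^ (-s)) ^ (1 / (s - 1)) := by
          have : 0 ≤ 1 / (s - 1) := one_div_nonneg.2 (by linarith)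
          gcongr
      _ = _ := by
          rw [← Real.rpow_mul hc0.le, Real.conjExponent]
          congr 1
          ring
  have hterm : ∀ j, ‖φ (((μ j ^ (1 / t) : ℝ) : 𝕜)⁻¹ • x j)‖ ^ P =
      (‖φ (x j)‖ / μ j) ^ P * μ j := by
    intro j
    rcases (hμ0 j).eq_or_lt with h | h
    · rw [hx0 j h.symm]; simp [← h, hP.pos.ne']
    · rw [map_smul, norm_smul, norm_inv, RCLike.norm_ofReal, abs_of_nonneg (by positivity),
        Real.mul_rpow (by positivity) (norm_nonneg _), Real.div_rpow (norm_nonneg _) h.le,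
        Real.inv_rpow (by positivity), ← Real.rpow_mul h.le]
      -- Conjugacy of `P` and `t` gives `P = P / t + 1`.
      have e : μ j ^ P = μ j ^ (1 / t * P) * μ j := by
        rw [← Real.rpow_add_one h.ne']
        congr 1
        have := hP.inv_add_inv_eq_one
        have hp := hP.pos.ne'
        have ht' := ht.ne'
        field_simp at this ⊢
        linarith
      rw [e]
      have : 0 < μ j ^ (1 / t * P) := by positivity
      field_simp
  rw [ENNReal.tsum_eq_iSup_sum]
  refine iSup_le fun F => ?_
  have hF : ∑ j ∈ F, ‖φ (((μ j ^ (1 / t) : ℝ) : 𝕜)⁻¹ • x j)‖ ^ P ≤ K := by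
    simp_rw [hterm]
    refine (sum_rpow_mul_le_of_weak_type hP.pos hPs hμ0
      (fun j => div_nonneg (norm_nonneg _) (hμ0 j)) (hweak F)).trans ?_
    rw [hK]
    gcongr
    exact hμs.sum_le_tsum F fun j _ => hμ0 j
  calc _ = ENNReal.ofReal (∑ j ∈ F, ‖φ (((μ j ^ (1 / t) : ℝ) : 𝕜)⁻¹ • x j)‖ ^ P) := by
        rw [ENNReal.ofReal_sum_of_nonneg fun _ _ => by positivity]
        refine Finset.sum_congr rfl fun j _ => ?_
        rw [← ofReal_norm, ENNReal.ofReal_rpow_of_nonneg (norm_nonneg _) hP.nonneg]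
    _ ≤ _ := ENNReal.ofReal_le_ofReal hF

end Splitting

/-! ### Abel–Dini and a converse of Hölder's inequality -/

section AbelDini

variable {d : ℕ → ℝ}

/-- Compares the integral of `x ^ (-1 - δ)` from `u` to `v` with the integrand at `v`; it telescopes
along partial sums. -/
theorem mul_rpow_neg_le_sub {δ u v : ℝ} (hδ : 0 < δ) (hu : 0 < u) (hv : 0 < v) :
    δ * ((v - u) / v ^ (1 + δ)) ≤ u ^ (-δ) - v ^ (-δ) := by
  have h1 : 1 + δ * (1 - u / v) ≤ (u / v) ^ (-δ) := by
    have hz : 0 < u / v := by positivity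
    rw [Real.rpow_def_of_pos hz]
    have := Real.add_one_le_exp (Real.log (u / v) * -δ)
    have := mul_le_mul_of_nonneg_left (Real.log_le_sub_one_of_pos hz) hδ.le
    linarith
  rw [Real.div_rpow hu.le hv.le, le_div_iff₀ (by positivity)] at h1
  have h2 : δ * ((v - u) / v ^ (1 + δ)) = δ * (1 - u / v) * v ^ (-δ) := by
    rw [Real.rpow_add hv, Real.rpow_one, Real.rpow_neg hv.le]
    field_simp
  linarith

/-- The convergence half of the Abel–Dini theorem. -/
theorem summable_div_rpow_partial_sum (hd : ∀ j, 0 ≤ d j) {κ : ℝ} (hκ : 1 < κ) :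
    Summable fun j => d j / (1 + ∑ i ∈ Finset.range (j + 1), d i) ^ κ := by
  set S : ℕ → ℝ := fun n => 1 + ∑ i ∈ Finset.range n, d i with hS
  have hS0 : ∀ n, 0 < S n := fun n => by
    have := Finset.sum_nonneg fun i (_ : i ∈ Finset.range n) => hd i
    simp only [hS]; linarith
  have hδ : 0 < κ - 1 := by linarith
  refine summable_of_sum_range_le (c := (κ - 1)⁻¹)
    (fun j => div_nonneg (hd j) (Real.rpow_nonneg (hS0 _).le _)) fun n => ?_
  have h1 : ∀ j, (κ - 1) * (d j / S (j + 1) ^ κ) ≤ S j ^ (-(κ - 1)) - S (j + 1) ^ (-(κ - 1)) := by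
    intro j
    have := mul_rpow_neg_le_sub hδ (hS0 j) (hS0 (j + 1))
    have e : S (j + 1) - S j = d j := by simp only [hS, Finset.sum_range_succ]; ring
    rwa [e, add_sub_cancel] at this
  have h2 : (κ - 1) * ∑ j ∈ Finset.range n, d j / S (j + 1) ^ κ ≤ 1 := by
    rw [Finset.mul_sum]
    refine (Finset.sum_le_sum fun j _ => h1 j).trans ?_
    rw [Finset.sum_range_sub']
    have : 0 ≤ S n ^ (-(κ - 1)) := Real.rpow_nonneg (hS0 n).le _
    have e : S 0 = 1 := by simp [hS]
    rw [e, Real.one_rpow]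
    linarith
  rw [← one_div, le_div_iff₀' hδ]
  exact h2

/-- The divergence half of the Abel–Dini theorem. -/
theorem summable_of_summable_div_partial_sum (hd : ∀ j, 0 ≤ d j)
    (h : Summable fun j => d j / (1 + ∑ i ∈ Finset.range (j + 1), d i)) : Summable d := by
  set S : ℕ → ℝ := fun n => 1 + ∑ i ∈ Finset.range n, d i with hS
  have hS0 : ∀ n, 0 < S n := fun n => by
    have := Finset.sum_nonneg fun i (_ : i ∈ Finset.range n) => hd i
    simp only [hS]; linarith
  have hmono : Monotone S := monotone_nat_of_le_succ fun n => by
    simp only [hS, Finset.sum_range_succ]; linarith [hd n]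
  have hf0 : ∀ j, 0 ≤ d j / S (j + 1) := fun j => div_nonneg (hd j) (hS0 _).le
  -- Past `m` the tail is below `1 / 2`, yet it dominates `(S (n + m) - S m) / S (n + m)`; hence `S
  -- (n + m) ≤ 2 * S m`.
  obtain ⟨m, hm⟩ := ((tendsto_sum_nat_add fun j => d j / S (j + 1)).eventually
    (gt_mem_nhds (one_half_pos (α := ℝ)))).exists
  refine summable_of_sum_range_le (c := 2 * S m) hd fun n => ?_
  have h1 : ∑ k ∈ Finset.range n, d (k + m) / S (k + m + 1) ≤ 1 / 2 :=
    ((((summable_nat_add_iff m).2 h).sum_le_tsum _ fun k _ => hf0 _).trans hm.le)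
  have h2 : (S (n + m) - S m) / S (n + m) ≤
      ∑ k ∈ Finset.range n, d (k + m) / S (k + m + 1) := by
    have e : S (n + m) - S m = ∑ k ∈ Finset.range n, d (k + m) := by
      simp only [hS]
      rw [add_comm n m, Finset.sum_range_add]
      simp only [add_comm m]
      ring
    rw [e, Finset.sum_div]
    refine Finset.sum_le_sum fun k hk => ?_
    have hk' := Finset.mem_range.1 hk
    exact div_le_div_of_nonneg_left (hd _) (hS0 _) (hmono (by omega))
  have h3 := h2.trans h1
  rw [div_le_iff₀ (hS0 _)] at h3
  have h4 : S n ≤ S (n + m) := hmono (by omega)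
  have h5 : S n = 1 + ∑ i ∈ Finset.range n, d i := rfl
  linarith

/-- A converse of Hölder's inequality, of Landau type: multipliers `β ^ 2` with `β` in `ℓ_{r'}`
that send `a` to `ℓ_ρ`, `1 / ρ = 1 / r + 2 / r'`, force `a` to be in `ℓ_r`. -/
theorem summable_rpow_of_forall_summable_sq_mul {r r' : ℝ} (hr : r.HolderConjugate r')
    {a : ℕ → ℝ} (ha : ∀ j, 0 ≤ a j)
    (h : ∀ β : ℕ → ℝ, (∀ j, 0 ≤ β j) → (Summable fun j => β j ^ r') →
      Summable fun j => (β j ^ 2 * a j) ^ (r / (2 * r - 1))) :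
    Summable fun j => a j ^ r := by
  have hr1 := hr.lt
  have hd : ∀ j, 0 ≤ a j ^ r := fun j => Real.rpow_nonneg (ha j) _
  have hr2 : r' = r / (r - 1) := hr.conjugate_eq
  have hκ : 1 < (2 * r - 1) / (2 * (r - 1)) := by
    rw [one_lt_div (by linarith)]; linarith
  refine summable_of_summable_div_partial_sum hd ?_
  set S : ℕ → ℝ := fun j => 1 + ∑ i ∈ Finset.range (j + 1), a i ^ r with hS
  have hS0 : ∀ j, 0 < S j := fun j => by
    have := Finset.sum_nonneg fun i (_ : i ∈ Finset.range (j + 1)) => hd i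
    simp only [hS]; linarith
  have hb : ∀ j, 0 ≤ a j ^ r / S j ^ ((2 * r - 1) / (2 * (r - 1))) := fun j =>
    div_nonneg (hd j) (Real.rpow_nonneg (hS0 j).le _)
  -- The exponent of `S j` is `r' / (2ρ)`, with `ρ = r / (2r - 1)`. It exceeds `1`, so `β` is in
  -- `ℓ_{r'}`, and it makes `(β² a) ^ ρ` equal to `a ^ r / S`.
  have hsum := h (fun j => (a j ^ r / S j ^ ((2 * r - 1) / (2 * (r - 1)))) ^ (1 / r'))
    (fun j => Real.rpow_nonneg (hb j) _) (by
      simp_rw [← Real.rpow_mul (hb _), one_div_mul_cancel hr.symm.pos.ne', Real.rpow_one]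
      exact summable_div_rpow_partial_sum hd hκ)
  refine hsum.congr fun j => ?_
  have hne : r - 1 ≠ 0 := by linarith
  have hne0 : r ≠ 0 := by linarith
  have hne2 : 2 * r - 1 ≠ 0 := by linarith
  have hq : 1 / r' = (r - 1) / r := by rw [hr2, one_div_div]
  rw [hq, Real.mul_rpow (by positivity) (ha j), ← Real.rpow_mul_natCast (hb j),
    ← Real.rpow_mul (hb j), Real.div_rpow (hd j) (Real.rpow_nonneg (hS0 j).le _),
    ← Real.rpow_mul (ha j), ← Real.rpow_mul (hS0 j).le, div_mul_eq_mul_div]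
  have e1 : (2 * r - 1) / (2 * (r - 1)) * ((r - 1) / r * (2 : ℕ) * (r / (2 * r - 1))) = 1 := by
    push_cast; field_simp
  have e2 : r * ((r - 1) / r * (2 : ℕ) * (r / (2 * r - 1))) + r / (2 * r - 1) = r := by
    have hv : (2 * r - 1) * (r / (2 * r - 1)) = r := mul_div_cancel₀ _ hne2
    have hc : r * ((r - 1) / r * (2 : ℕ) * (r / (2 * r - 1))) =
        2 * (r - 1) * (r / (2 * r - 1)) := by
      rw [mul_assoc ((r - 1) / r), ← mul_assoc r, mul_div_cancel₀ _ hne0]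
      push_cast; ring
    rw [hc]
    linarith
  rw [e1, Real.rpow_one, ← Real.rpow_add_of_nonneg (ha j), e2]
  · have : 0 ≤ 2 * r - 1 := by linarith
    have : 0 ≤ r - 1 := by linarith
    positivity
  · exact div_nonneg (by linarith) (by linarith)

end AbelDini

/-! ### The inclusion theorem -/

section Inclusion

variable {𝕜 : Type*} [RCLike 𝕜] {n : ℕ} {X : Fin n → Type*}
  [∀ i, NormedAddCommGroup (X i)] [∀ i, NormedSpace 𝕜 (X i)]
  {Y : Type*} [NormedAddCommGroup Y] [NormedSpace 𝕜 Y]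

theorem mem_absSumming_iff {p : ℝ} (hp : 0 < p) {q : Fin n → ℝ}
    {T : ContinuousMultilinearMap 𝕜 X Y} :
    T ∈ absSumming 𝕜 X Y p q ↔ ∀ x : ∀ i, ℕ → X i, (∀ i, WeaklySummable 𝕜 (q i) (x i)) →
      Summable fun j => ‖T fun i => x i j‖ ^ p := by
  have h : 0 < (ENNReal.ofReal p).toReal := by rwa [ENNReal.toReal_ofReal hp.le]
  simp only [absSumming, Set.mem_ofPred_eq, memℓp_gen_iff h, ENNReal.toReal_ofReal hp.le]

theorem prod_ite_ite_one {ι M : Type*} [Fintype ι] [DecidableEq ι] [CommMonoid M] {i₀ i₁ : ι}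
    (h : i₀ ≠ i₁) (a b : M) :
    ∏ i, (if i = i₀ then a else if i = i₁ then b else 1) = a * b := by
  rw [Finset.prod_eq_mul i₀ i₁ h]
  · simp [h.symm]
  · rintro c - ⟨h0, h1⟩
    simp [h0, h1]
  · simp
  · simp

/-- Pointwise form of three-factor Hölder: weighted AM–GM with weights `ρ/t`, `ρ/t`, `ρ/p`. -/
theorem mul_mul_rpow_le {a b c t p ρ : ℝ} (ha : 0 ≤ a) (hb : 0 ≤ b) (hc : 0 ≤ c) (ht : 0 < t)
    (hp : 0 < p) (hρ : 0 < ρ) (h : 2 / t + 1 / p = 1 / ρ) :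
    (a * b * c) ^ ρ ≤ a ^ t + b ^ t + c ^ p := by
  have hw : ρ / t + ρ / t + ρ / p = 1 := by
    have : ρ * (2 / t + 1 / p) = 1 := by rw [h]; field_simp
    rw [← this]; ring
  have h1 : 0 < ρ / t := by positivity
  have h2 : 0 < ρ / p := by positivity
  have key := Real.geom_mean_le_arith_mean3_weighted h1.le h1.le h2.le
    (Real.rpow_nonneg ha t) (Real.rpow_nonneg hb t) (Real.rpow_nonneg hc p) hw
  rw [← Real.rpow_mul ha, ← Real.rpow_mul hb, ← Real.rpow_mul hc, mul_div_cancel₀ _ ht.ne',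
    mul_div_cancel₀ _ hp.ne', ← Real.mul_rpow ha hb, ← Real.mul_rpow (by positivity) hc] at key
  refine key.trans ?_
  gcongr
  · exact mul_le_of_le_one_left (by positivity) (by linarith)
  · exact mul_le_of_le_one_left (by positivity) (by linarith)
  · exact mul_le_of_le_one_left (by positivity) (by linarith)

/-- Multipliers that turn two of the arguments into weakly `1`-summable sequences gain summability
of the values of `T`, by factoring both products. -/
theorem summable_sq_mul_norm_rpow {p P t ρ : ℝ} {q : Fin n → ℝ}
    {T : ContinuousMultilinearMap 𝕜 X Y} (hp : 0 < p) (hT : T ∈ absSumming 𝕜 X Y p q)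
    {i₀ i₁ : Fin n} (hi : i₀ ≠ i₁) {s₀ s₁ : ℝ} (hs₀ : 1 < s₀) (hs₁ : 1 < s₁)
    (hX₀ : HasCotype (X i₀) s₀) (hX₁ : HasCotype (X i₁) s₁) (hP : P.HolderConjugate t)
    (hP₀ : P < Real.conjExponent s₀) (hP₁ : P < Real.conjExponent s₁)
    (hq₀ : P ≤ q i₀) (hq₁ : P ≤ q i₁) (hρ : 0 < ρ) (hρt : 2 / t + 1 / p = 1 / ρ)
    {x : ∀ i, ℕ → X i} (hx : ∀ i, i ≠ i₀ → i ≠ i₁ → WeaklySummable 𝕜 (q i) (x i))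
    {β : ℕ → ℝ} (hβ : ∀ j, 0 ≤ β j)
    (hx₀ : WeaklySummable 𝕜 1 fun j => (β j : 𝕜) • x i₀ j)
    (hx₁ : WeaklySummable 𝕜 1 fun j => (β j : 𝕜) • x i₁ j) :
    Summable fun j => (β j ^ 2 * ‖T fun i => x i j‖) ^ ρ := by
  obtain ⟨a₀, y₀, ha₀, hs₀, hy₀, he₀⟩ := hX₀.exists_smul_eq hs₀ hP hP₀ hx₀
  obtain ⟨a₁, y₁, ha₁, hs₁, hy₁, he₁⟩ := hX₁.exists_smul_eq hs₁ hP hP₁ hx₁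
  let y : ∀ i, ℕ → X i := Function.update (Function.update x i₁ y₁) i₀ y₀
  have hy0 : y i₀ = y₀ := by simp [y]
  have hy1 : y i₁ = y₁ := by simp [y, hi.symm]
  have hyne : ∀ i, i ≠ i₀ → i ≠ i₁ → y i = x i := fun i h0 h1 => by simp [y, h0, h1]
  have hy : ∀ i, WeaklySummable 𝕜 (q i) (y i) := by
    intro i
    by_cases h0 : i = i₀
    · subst h0; rw [hy0]; exact hy₀.mono hP.pos hq₀
    by_cases h1 : i = i₁
    · subst h1; rw [hy1]; exact hy₁.mono hP.pos hq₁
    rw [hyne i h0 h1]; exact hx i h0 h1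
  have hTy := (mem_absSumming_iff hp).1 hT y hy
  have key : ∀ j, β j ^ 2 * ‖T fun i => x i j‖ = a₀ j * a₁ j * ‖T fun i => y i j‖ := by
    intro j
    -- Both sides are the same point of the product space, scaled in coordinates `i₀` and `i₁` only;
    -- multilinearity pulls out `β²` and `α₀ α₁`.
    have e : (fun i => (if i = i₀ then (β j : 𝕜) else if i = i₁ then (β j : 𝕜) else 1) • x i j) =
        fun i => (if i = i₀ then (a₀ j : 𝕜) else if i = i₁ then (a₁ j : 𝕜) else 1) • y i j := by
      funext i
      by_cases h0 : i = i₀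
      · subst h0; simpa [hy0] using he₀ j
      by_cases h1 : i = i₁
      · subst h1; simpa [hy1, h0] using he₁ j
      simp [h0, h1, hyne i h0 h1]
    have e2 := congrArg (fun z => ‖T z‖) e
    simp only [T.map_smul_univ, prod_ite_ite_one hi, norm_smul, norm_mul, RCLike.norm_ofReal,
      abs_of_nonneg (hβ j), abs_of_nonneg (ha₀ j), abs_of_nonneg (ha₁ j)] at e2
    rw [sq, e2]
  refine Summable.of_nonneg_of_le (fun j => Real.rpow_nonneg
    (mul_nonneg (sq_nonneg _) (norm_nonneg _)) _) (fun j => ?_) ((hs₀.add hs₁).add hTy)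
  rw [key]
  exact mul_mul_rpow_le (ha₀ j) (ha₁ j) (norm_nonneg _) hP.symm.pos hp hρ hρt

/-- The inclusion theorem for absolutely summing multilinear operators when two of the domain
spaces have finite cotype. -/
theorem absSumming_subset_of_hasCotype {p r : ℝ} (hr : 1 ≤ r) (hrp : r < p) {q q' : Fin n → ℝ}
    (hq' : ∀ i, 0 < q' i) (hq : ∀ i, q' i ≤ q i) {i₀ i₁ : Fin n} (hi : i₀ ≠ i₁)
    (h₀ : q i₀ = p) (h₁ : q i₁ = p) (h₀' : q' i₀ = r) (h₁' : q' i₁ = r)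
    {s₀ s₁ : ℝ} (hs₀ : 1 < s₀) (hs₁ : 1 < s₁)
    (hX₀ : HasCotype (X i₀) s₀) (hX₁ : HasCotype (X i₁) s₁)
    (hp₀ : p ≤ Real.conjExponent s₀) (hp₁ : p ≤ Real.conjExponent s₁) :
    absSumming 𝕜 X Y p q ⊆ absSumming 𝕜 X Y r q' := by
  intro T hT
  have hr0 : 0 < r := by linarith
  have hp0 : 0 < p := by linarith
  refine (mem_absSumming_iff hr0).2 fun x hx => ?_
  have hPr : r < 2 * r * p / (r + p) := by
    rw [lt_div_iff₀ (by linarith)]; nlinarith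
  have hPp : 2 * r * p / (r + p) < p := by
    rw [div_lt_iff₀ (by linarith)]; nlinarith
  -- The harmonic mean of `r` and `p`; `P < p` strictly, so `p = s*` is allowed.
  set P := 2 * r * p / (r + p) with hPdef
  have hP : P.HolderConjugate (Real.conjExponent P) :=
    Real.HolderConjugate.conjExponent (by linarith)
  have hρ : 0 < r / (2 * r - 1) := div_pos hr0 (by linarith)
  have hρt : 2 / Real.conjExponent P + 1 / p = 1 / (r / (2 * r - 1)) := by
    have e1 : (Real.conjExponent P)⁻¹ = 1 - P⁻¹ := by linarith [hP.inv_add_inv_eq_one]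
    have e2 : P⁻¹ = (r + p) / (2 * r * p) := by rw [hPdef, inv_div]
    rw [div_eq_mul_inv 2, e1, e2, one_div_div]
    field_simp
    ring
  have hx' : ∀ i, WeaklySummable 𝕜 (q i) (x i) := fun i => (hx i).mono (hq' i) (hq i)
  have hmain := fun (β : ℕ → ℝ) (hβ : ∀ j, 0 ≤ β j) =>
    summable_sq_mul_norm_rpow (β := β) hp0 hT hi hs₀ hs₁ hX₀ hX₁ hP (hPp.trans_le hp₀)
      (hPp.trans_le hp₁) (hPp.le.trans h₀.ge) (hPp.le.trans h₁.ge) hρ hρt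
      (fun i _ _ => hx' i) hβ
  have hx₀ := hx i₀
  have hx₁ := hx i₁
  rw [h₀'] at hx₀
  rw [h₁'] at hx₁
  -- At `r = 1` the conjugate exponent is infinite; `β = 1` works directly, since `ρ = 1`.
  rcases hr.eq_or_lt with rfl | hr1
  · have := hmain (fun _ => 1) (fun _ => zero_le_one) (by simpa using hx₀) (by simpa using hx₁)
    norm_num at this
    simpa using this
  · have hr' := Real.HolderConjugate.conjExponent hr1
    exact summable_rpow_of_forall_summable_sq_mul hr' (fun j => norm_nonneg _) fun β hβ hs =>
      hmain β hβ (hx₀.smul hr' hβ hs) (hx₁.smul hr' hβ hs)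

end Inclusion

theorem corollary2p4 {𝕜 : Type*} [RCLike 𝕜] {n k : ℕ} (hk : 2 ≤ k) (hkn : k ≤ n)
    (X : Fin n → Type*) [∀ i, NormedAddCommGroup (X i)] [∀ i, NormedSpace 𝕜 (X i)]
    [∀ i, CompleteSpace (X i)]
    (Y : Type*) [NormedAddCommGroup Y] [NormedSpace 𝕜 Y] [CompleteSpace Y]
    (s : Fin k → ℝ) (hs : ∀ j, 2 ≤ s j)
    (hcotype : ∀ j : Fin k, HasCotype (X (Fin.castLE hkn j)) (s j))
    (hsum : 1 ≤ ∑ j, 1 / s j)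
    (p r : ℝ) (hr : 1 ≤ r) (hrp : r < p)
    (hp : (∃ j, s j ≠ 2) → ∀ j, p < Real.conjExponent (s j))
    (hp_two : (∀ j, s j = 2) → p ≤ 2) :
    (∀ q : ℝ, 1 ≤ q →
      absSumming 𝕜 X Y p (splitExponents n k p q) ⊆
        absSumming 𝕜 X Y r (splitExponents n k r q)) ∧
    absSumming 𝕜 X Y p (fun _ => p) ⊆ absSumming 𝕜 X Y r (fun _ => r) := by
  have hps : ∀ j, p ≤ Real.conjExponent (s j) := by
    intro j
    by_cases h : ∃ j, s j ≠ 2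
    · exact (hp h j).le
    · push Not at h
      rw [h j, Real.conjExponent]
      exact (hp_two h).trans (by norm_num)
  have hs1 : ∀ j, 1 < s j := fun j => by linarith [hs j]
  -- `2 ≤ k` provides the two cotype coordinates.
  let j₀ : Fin k := ⟨0, by omega⟩
  let j₁ : Fin k := ⟨1, by omega⟩
  have hne : Fin.castLE hkn j₀ ≠ Fin.castLE hkn j₁ := by simp [j₀, j₁, Fin.ext_iff]
  have hlt : ∀ (j : Fin k), ((Fin.castLE hkn j : Fin n) : ℕ) < k := fun j => j.2
  refine ⟨fun q hq => ?_, ?_⟩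
  · refine absSumming_subset_of_hasCotype hr hrp (fun i => ?_) (fun i => ?_) hne
      (if_pos (hlt j₀)) (if_pos (hlt j₁)) (if_pos (hlt j₀)) (if_pos (hlt j₁)) (hs1 j₀) (hs1 j₁)
      (hcotype j₀) (hcotype j₁) (hps j₀) (hps j₁)
    · unfold splitExponents
      split_ifs <;> linarith
    · unfold splitExponents
      split_ifs <;> linarith
  · exact absSumming_subset_of_hasCotype hr hrp (fun _ => by linarith) (fun _ => hrp.le) hne
      rfl rfl rfl rfl (hs1 j₀) (hs1 j₁) (hcotype j₀) (hcotype j₁) (hps j₀) (hps j₁)
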